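/- Let $\mathbb{H}^3$ be hyperbolic $3$-space of constant sectional curvature $-1$. Let $p\in\mathbb{H}^3$, let $v,w\in T_p\mathbb{H}^3$ be orthonormal, let $\mathcal{R}_v\cong SO(2)$ be the group of isometries $\varphi$ of $\mathbb{H}^3$ with $\varphi(p)=p$, $\varphi_*(v)=v$ and $\det\varphi_*=1$ on $T_p\mathbb{H}^3$ (the rotations about the geodesic $\gamma_v(t)=\exp_p(tv)$), and let $\Pi^+_{v,w}=\{\exp_p(t_1v+t_2w): t_1\in\mathbb{R},\ t_2>0\}$. Let $\beta:[0,\infty)\to\Pi^+_{v,w}$ be a smooth regular curve of infinite length. The complete end of revolution $E$ along $\gamma_v$ with generating curve $\beta$ is the set $E=\{\varphi(\beta(t)): t\ge 0,\ \varphi\in\mathcal{R}_v\}$, regarded as the immersed surface with boundary given by $\alpha:[0,\infty)\times\mathbb{S}^1\to\mathbb{H}^3$, $\alpha(t,\theta)=R_\theta(\beta(t))$, with the metric induced from $\mathbb{H}^3$, where $R_\theta\in\mathcal{R}_v$ is the rotation by the angle $\theta$. If $E$ is contained in a compact subset of $\mathbb{H}^3$, then $E$ is parabolic: any two bounded continuous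 functions on $[0,\infty)\times\mathbb{S}^1$ that are harmonic (of class $C^2$ and annihilated by the Laplace–Beltrami operator of the induced metric) on $(0,\infty)\times\mathbb{S}^1$ and that agree on the boundary $\{0\}\times\mathbb{S}^1$ are equal. -/

import Mathlib

open Set Filter
open scoped ContDiff

noncomputable section

namespace HypRev

/-! ### Hyperbolic three-space, hyperboloid model -/

/-- The Lorentz form of signature `(-,+,+,+)` on `ℝ⁴`. Its restriction to the tangent spaces of the
hyperboloid `H3` is the hyperbolic metric (constant curvature `-1`). -/
def mink (x y : Fin 4 → ℝ) : ℝ := -(x 0 * y 0) + x 1 * y 1 + x 2 * y 2 + x 3 * y 3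

/-- Hyperbolic space `ℍ³`: the upper sheet of the hyperboloid `⟨x, x⟩ = -1`. -/
def H3 : Set (Fin 4 → ℝ) := {x | mink x x = -1 ∧ 0 < x 0}

/-- The Riemannian exponential map of `ℍ³` at `p`, applied to a tangent vector `u ⟂ p`:
`exp_p(u) = cosh |u| p + (sinh |u| / |u|) u` (and `exp_p(0) = p`). -/
def hypExp (p u : Fin 4 → ℝ) : Fin 4 → ℝ :=
  Real.cosh (Real.sqrt (mink u u)) • p
    + (Real.sinh (Real.sqrt (mink u u)) / Real.sqrt (mink u u)) • u

/-- `p ∈ ℍ³` and `(v, w, n)` is an orthonormal basis of the tangent space `T_p ℍ³ = p^⟂`. -/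
structure IsFrame (p v w n : Fin 4 → ℝ) : Prop where
  mem : p ∈ H3
  pv : mink p v = 0
  pw : mink p w = 0
  pn : mink p n = 0
  vv : mink v v = 1
  ww : mink w w = 1
  nn : mink n n = 1
  vw : mink v w = 0
  vn : mink v n = 0
  wn : mink w n = 0

/-! ### Ends of revolution -/

/-- The group `𝓡_v` of rotations along the geodesic `γ_v(t) = exp_p(t v)`: the isometries `φ` of
`ℍ³` with `φ(p) = p`, `φ_*(v) = v` and `det φ_* = 1`. The isometries of the hyperboloid are the
restrictions of the linear maps that preserve the Lorentz form and the upper sheet; the latter is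
automatic from `φ p = p`, the differential at `p` is the restriction of `φ` to `p^⟂`, and because
`φ p = p` the determinant of that restriction is `det φ`. -/
def rotationGroup (p v : Fin 4 → ℝ) : Set ((Fin 4 → ℝ) →ₗ[ℝ] (Fin 4 → ℝ)) :=
  {φ | (∀ x y, mink (φ x) (φ y) = mink x y) ∧ φ p = p ∧ φ v = v ∧ LinearMap.det φ = 1}

/-- The totally geodesic open half-plane `Π⁺_{v,w} = {exp_p(t₁ v + t₂ w) : t₁ ∈ ℝ, t₂ > 0}`,
bounded by the geodesic `γ_v`. -/
def halfPlane (p v w : Fin 4 → ℝ) : Set (Fin 4 → ℝ) :=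
  {x | ∃ t₁ t₂ : ℝ, 0 < t₂ ∧ x = hypExp p (t₁ • v + t₂ • w)}

/-- The velocity of a curve `β : [0,∞) → ℍ³` (one-sided at `0`). -/
def velocity (β : ℝ → Fin 4 → ℝ) (t : ℝ) : Fin 4 → ℝ := derivWithin β (Ici 0) t

/-- A generating curve: a smooth regular curve `β : [0,∞) → Π⁺_{v,w}`. -/
structure IsGeneratingCurve (p v w : Fin 4 → ℝ) (β : ℝ → Fin 4 → ℝ) : Prop where
  smooth : ContDiffOn ℝ ∞ β (Ici 0)
  regular : ∀ t, 0 ≤ t → velocity β t ≠ 0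
  mem : ∀ t, 0 ≤ t → β t ∈ halfPlane p v w

/-- The curve `β : [0,∞) → ℍ³` has infinite hyperbolic length. -/
def HasInfiniteLength (β : ℝ → Fin 4 → ℝ) : Prop :=
  Tendsto (fun T : ℝ => ∫ t in (0 : ℝ)..T, Real.sqrt (mink (velocity β t) (velocity β t)))
    atTop atTop

/-- The end of revolution along `γ_v` with generating curve `β`, as a subset of `ℍ³`:
`E = {φ(β(t)) : t ∈ [0,∞), φ ∈ 𝓡_v}`. -/
def endOfRevolution (p v : Fin 4 → ℝ) (β : ℝ → Fin 4 → ℝ) : Set (Fin 4 → ℝ) :=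
  {x | ∃ t, 0 ≤ t ∧ ∃ φ ∈ rotationGroup p v, x = φ (β t)}

/-- The rotation by the angle `θ` along `γ_v`: it fixes `p` and `v` and rotates the plane spanned
by `w` and `n`. -/
def rotation (p v w n : Fin 4 → ℝ) (θ : ℝ) : (Fin 4 → ℝ) →ₗ[ℝ] (Fin 4 → ℝ) where
  toFun x := -(mink x p) • p + mink x v • v
    + mink x w • (Real.cos θ • w + Real.sin θ • n)
    + mink x n • (-Real.sin θ • w + Real.cos θ • n)
  map_add' x y := by
    ext i
    simp [mink]
    ring
  map_smul' c x := by
    ext i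
    simp [mink]
    ring

/-- The immersion `α(t, θ) = f(θ)(β(t))` of `[0,∞) × 𝕊¹` onto the end of revolution, where
`f(θ)` is the rotation by the angle `θ`; the circle is `ℝ/2πℤ`, and `α` is `2π`-periodic in `θ`. -/
def immersion (p v w n : Fin 4 → ℝ) (β : ℝ → Fin 4 → ℝ) (q : ℝ × ℝ) : Fin 4 → ℝ :=
  rotation p v w n q.2 (β q.1)

/-! ### Parabolicity -/

/-- Partial derivative in the first variable `t`. -/
def d₁ {V : Type*} [NormedAddCommGroup V] [NormedSpace ℝ V] (F : ℝ × ℝ → V) (q : ℝ × ℝ) : V :=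
  deriv (fun s => F (s, q.2)) q.1

/-- Partial derivative in the second variable `θ`. -/
def d₂ {V : Type*} [NormedAddCommGroup V] [NormedSpace ℝ V] (F : ℝ × ℝ → V) (q : ℝ × ℝ) : V :=
  deriv (fun s => F (q.1, s)) q.2

/-- Coefficient `g₁₁` of the metric induced by `X`. -/
def g₁₁ (X : ℝ × ℝ → Fin 4 → ℝ) (q : ℝ × ℝ) : ℝ := mink (d₁ X q) (d₁ X q)

/-- Coefficient `g₁₂` of the metric induced by `X`. -/
def g₁₂ (X : ℝ × ℝ → Fin 4 → ℝ) (q : ℝ × ℝ) : ℝ := mink (d₁ X q) (d₂ X q)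

/-- Coefficient `g₂₂` of the metric induced by `X`. -/
def g₂₂ (X : ℝ × ℝ → Fin 4 → ℝ) (q : ℝ × ℝ) : ℝ := mink (d₂ X q) (d₂ X q)

/-- The area density `√(det g)` of the metric induced by `X`. -/
def area (X : ℝ × ℝ → Fin 4 → ℝ) (q : ℝ × ℝ) : ℝ :=
  Real.sqrt (g₁₁ X q * g₂₂ X q - g₁₂ X q ^ 2)

/-- The Laplace–Beltrami operator of the metric induced by `X`,
`Δu = (1/√det g) ∑ᵢⱼ ∂ᵢ(√det g gⁱʲ ∂ⱼu)`, where `√det g g¹¹ = g₂₂/√det g`,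
`√det g g¹² = -g₁₂/√det g` and `√det g g²² = g₁₁/√det g`. -/
def laplacian (X : ℝ × ℝ → Fin 4 → ℝ) (u : ℝ × ℝ → ℝ) (q : ℝ × ℝ) : ℝ :=
  (area X q)⁻¹ *
    (d₁ (fun r => (g₂₂ X r * d₁ u r - g₁₂ X r * d₂ u r) / area X r) q
      + d₂ (fun r => (g₁₁ X r * d₂ u r - g₁₂ X r * d₁ u r) / area X r) q)

/-- `u` is a bounded harmonic function on the end `[0,∞) × 𝕊¹` with the metric induced by `X`:
a function on `[0,∞) × ℝ/2πℤ`, bounded, continuous up to the boundary `{0} × 𝕊¹`, and of class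
`C²` with `Δu = 0` in the interior. -/
structure IsBoundedHarmonic (X : ℝ × ℝ → Fin 4 → ℝ) (u : ℝ × ℝ → ℝ) : Prop where
  periodic : ∀ t θ : ℝ, 0 ≤ t → u (t, θ + 2 * Real.pi) = u (t, θ)
  bounded : ∃ C : ℝ, ∀ t θ : ℝ, 0 ≤ t → |u (t, θ)| ≤ C
  continuousOn : ContinuousOn u (Ici 0 ×ˢ univ)
  contDiffOn : ContDiffOn ℝ 2 u (Ioi 0 ×ˢ univ)
  harmonic : ∀ t θ : ℝ, 0 < t → laplacian X u (t, θ) = 0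

/-- The end `[0,∞) × 𝕊¹`, with the metric induced by the immersion `X`, is parabolic: every bounded
harmonic function on it is determined by its boundary values. -/
def IsParabolic (X : ℝ × ℝ → Fin 4 → ℝ) : Prop :=
  ∀ u₁ u₂ : ℝ × ℝ → ℝ, IsBoundedHarmonic X u₁ → IsBoundedHarmonic X u₂ →
    (∀ θ : ℝ, u₁ (0, θ) = u₂ (0, θ)) → ∀ t θ : ℝ, 0 ≤ t → u₁ (t, θ) = u₂ (t, θ)

/-! ### The rotations by an angle are exactly the group `𝓡_v` -/

theorem mink_comm (x y : Fin 4 → ℝ) : mink x y = mink y x := by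
  simp only [mink]; ring

theorem mink_add_left (x y z : Fin 4 → ℝ) : mink (x + y) z = mink x z + mink y z := by
  simp only [mink, Pi.add_apply]; ring

theorem mink_smul_left (c : ℝ) (x z : Fin 4 → ℝ) : mink (c • x) z = c * mink x z := by
  simp only [mink, Pi.smul_apply, smul_eq_mul]; ring

theorem mink_add_right (x y z : Fin 4 → ℝ) : mink x (y + z) = mink x y + mink x z := by
  simp only [mink, Pi.add_apply]; ring

theorem mink_smul_right (c : ℝ) (x z : Fin 4 → ℝ) : mink x (c • z) = c * mink x z := by
  simp only [mink, Pi.smul_apply, smul_eq_mul]; ring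

/-- Expansion of a vector in a Lorentz orthonormal frame. -/
theorem IsFrame.expand {p v w n : Fin 4 → ℝ} (h : IsFrame p v w n) (x : Fin 4 → ℝ) :
    x = -(mink x p) • p + mink x v • v + mink x w • w + mink x n • n := by
  have hpp := h.mem.1
  have h1 := h.pv
  have h2 := h.pw
  have h3 := h.pn
  have h4 := h.vv
  have h5 := h.ww
  have h6 := h.nn
  have h7 := h.vw
  have h8 := h.vn
  have h9 := h.wn
  simp only [mink] at hpp h1 h2 h3 h4 h5 h6 h7 h8 h9
  have key : (Matrix.of ![![p 0, p 1, p 2, p 3], ![v 0, v 1, v 2, v 3], ![w 0, w 1, w 2, w 3],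
        ![n 0, n 1, n 2, n 3]] : Matrix (Fin 4) (Fin 4) ℝ)
      * Matrix.of ![![p 0, -v 0, -w 0, -n 0], ![-p 1, v 1, w 1, n 1], ![-p 2, v 2, w 2, n 2],
        ![-p 3, v 3, w 3, n 3]] = 1 := by
    ext i j
    fin_cases i <;> fin_cases j <;>
      simp [Matrix.mul_apply, Fin.sum_univ_four] <;> linarith
  have key2 := mul_eq_one_comm.mp key
  have hk := fun i j => congrFun (congrFun key2 i) j
  have e : ∀ i j : Fin 4, (Matrix.of ![![p 0, -v 0, -w 0, -n 0], ![-p 1, v 1, w 1, n 1],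
      ![-p 2, v 2, w 2, n 2], ![-p 3, v 3, w 3, n 3]] : Matrix (Fin 4) (Fin 4) ℝ) i 0 * p j
      + (Matrix.of ![![p 0, -v 0, -w 0, -n 0], ![-p 1, v 1, w 1, n 1],
      ![-p 2, v 2, w 2, n 2], ![-p 3, v 3, w 3, n 3]] : Matrix (Fin 4) (Fin 4) ℝ) i 1 * v j
      + (Matrix.of ![![p 0, -v 0, -w 0, -n 0], ![-p 1, v 1, w 1, n 1],
      ![-p 2, v 2, w 2, n 2], ![-p 3, v 3, w 3, n 3]] : Matrix (Fin 4) (Fin 4) ℝ) i 2 * w j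
      + (Matrix.of ![![p 0, -v 0, -w 0, -n 0], ![-p 1, v 1, w 1, n 1],
      ![-p 2, v 2, w 2, n 2], ![-p 3, v 3, w 3, n 3]] : Matrix (Fin 4) (Fin 4) ℝ) i 3 * n j
      = (1 : Matrix (Fin 4) (Fin 4) ℝ) i j := by
    intro i j
    rw [← hk i j, Matrix.mul_apply, Fin.sum_univ_four]
    fin_cases j <;> simp
  ext j
  have e0 := e 0 j
  have e1 := e 1 j
  have e2 := e 2 j
  have e3 := e 3 j
  simp only [Matrix.of_apply, Matrix.cons_val] at e0 e1 e2 e3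
  have hx : x j = x 0 * (1 : Matrix (Fin 4) (Fin 4) ℝ) 0 j
      + x 1 * (1 : Matrix (Fin 4) (Fin 4) ℝ) 1 j
      + x 2 * (1 : Matrix (Fin 4) (Fin 4) ℝ) 2 j + x 3 * (1 : Matrix (Fin 4) (Fin 4) ℝ) 3 j := by
    fin_cases j <;> simp [Matrix.one_apply]
  rw [hx, ← e0, ← e1, ← e2, ← e3]
  simp only [mink, Pi.add_apply, Pi.smul_apply, smul_eq_mul]
  ring

/-- A linear map that fixes `p`, `v` and acts by a `2 × 2` matrix on `w`, `n` has the determinant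
of that matrix. -/
theorem IsFrame.det_eq {p v w n : Fin 4 → ℝ} (h : IsFrame p v w n)
    (φ : (Fin 4 → ℝ) →ₗ[ℝ] (Fin 4 → ℝ)) (a b c d : ℝ) (hp : φ p = p) (hv : φ v = v)
    (hw : φ w = a • w + b • n) (hn : φ n = c • w + d • n) :
    LinearMap.det φ = a * d - b * c := by
  have hspan : ⊤ ≤ Submodule.span ℝ (Set.range ![p, v, w, n]) := by
    intro x _
    rw [h.expand x]
    have hm : ∀ i, ![p, v, w, n] i ∈ Submodule.span ℝ (Set.range ![p, v, w, n]) :=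
      fun i => Submodule.subset_span ⟨i, rfl⟩
    exact add_mem (add_mem (add_mem (Submodule.smul_mem _ _ (hm 0)) (Submodule.smul_mem _ _ (hm 1)))
      (Submodule.smul_mem _ _ (hm 2))) (Submodule.smul_mem _ _ (hm 3))
  let B := basisOfTopLeSpanOfCardEqFinrank ![p, v, w, n] hspan (by simp)
  have hB : ⇑B = ![p, v, w, n] := coe_basisOfTopLeSpanOfCardEqFinrank _ _ _
  have b0 : B 0 = p := by rw [hB]; rfl
  have b1 : B 1 = v := by rw [hB]; rfl
  have b2 : B 2 = w := by rw [hB]; rfl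
  have b3 : B 3 = n := by rw [hB]; rfl
  have hM : LinearMap.toMatrix B B φ
      = Matrix.of ![![1, 0, 0, 0], ![0, 1, 0, 0], ![0, 0, a, c], ![0, 0, b, d]] := by
    ext i j
    rw [LinearMap.toMatrix_apply]
    fin_cases j
    · have : φ (B 0) = B 0 := by rw [b0, hp]
      simp only [Fin.zero_eta, this, Module.Basis.repr_self]
      fin_cases i <;> simp
    · have : φ (B 1) = B 1 := by rw [b1, hv]
      simp only [Fin.mk_one, this, Module.Basis.repr_self]
      fin_cases i <;> simp
    · have : φ (B 2) = a • B 2 + b • B 3 := by rw [b2, b3, hw]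
      simp only [Fin.reduceFinMk, this, map_add, map_smul, Module.Basis.repr_self]
      fin_cases i <;> simp
    · have : φ (B 3) = c • B 2 + d • B 3 := by rw [b2, b3, hn]
      simp only [Fin.reduceFinMk, this, map_add, map_smul, Module.Basis.repr_self]
      fin_cases i <;> simp
  rw [← LinearMap.det_toMatrix B, hM]
  simp [Matrix.det_succ_row_zero, Fin.sum_univ_succ, Fin.succAbove]
  ring

/-- The rotations by an angle are exactly the elements of `𝓡_v`. -/
theorem IsFrame.mem_rotationGroup_iff {p v w n : Fin 4 → ℝ} (h : IsFrame p v w n)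
    (φ : (Fin 4 → ℝ) →ₗ[ℝ] (Fin 4 → ℝ)) :
    φ ∈ rotationGroup p v ↔ ∃ θ, φ = rotation p v w n θ := by
  have hpp := h.mem.1
  have hvp : mink v p = 0 := (mink_comm _ _).trans h.pv
  have hwp : mink w p = 0 := (mink_comm _ _).trans h.pw
  have hnp : mink n p = 0 := (mink_comm _ _).trans h.pn
  have hwv : mink w v = 0 := (mink_comm _ _).trans h.vw
  have hnv : mink n v = 0 := (mink_comm _ _).trans h.vn
  have hnw : mink n w = 0 := (mink_comm _ _).trans h.wn
  constructor
  · rintro ⟨hiso, hp, hv, hdet⟩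
    have hw0 := h.expand (φ w)
    have hn0 := h.expand (φ n)
    have a1 : mink (φ w) p = 0 := by rw [← hwp, ← hiso w p, hp]
    have a2 : mink (φ w) v = 0 := by rw [← hwv, ← hiso w v, hv]
    have a3 : mink (φ n) p = 0 := by rw [← hnp, ← hiso n p, hp]
    have a4 : mink (φ n) v = 0 := by rw [← hnv, ← hiso n v, hv]
    rw [a1, a2] at hw0
    rw [a3, a4] at hn0
    generalize mink (φ w) w = a at hw0
    generalize mink (φ w) n = b at hw0
    generalize mink (φ n) w = c at hn0
    generalize mink (φ n) n = d at hn0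
    simp only [neg_zero, zero_smul, zero_add] at hw0 hn0
    have hd := h.det_eq φ a b c d hp hv hw0 hn0
    rw [hdet] at hd
    have e1 : a ^ 2 + b ^ 2 = 1 := by
      have := hiso w w
      rw [hw0] at this
      simp only [mink_add_left, mink_add_right, mink_smul_left, mink_smul_right, h.ww, h.nn,
        h.wn, hnw] at this
      linarith
    have e2 : c ^ 2 + d ^ 2 = 1 := by
      have := hiso n n
      rw [hn0] at this
      simp only [mink_add_left, mink_add_right, mink_smul_left, mink_smul_right, h.ww, h.nn,
        h.wn, hnw] at this
      linarith
    have e3 : (d - a) ^ 2 + (c + b) ^ 2 = 0 := by linarith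
    have hda : d = a := by nlinarith [sq_nonneg (d - a), sq_nonneg (c + b)]
    have hcb : c = -b := by nlinarith [sq_nonneg (d - a), sq_nonneg (c + b)]
    obtain ⟨θ, hc, hs⟩ : ∃ θ, Real.cos θ = a ∧ Real.sin θ = b := by
      have hz : ‖(⟨a, b⟩ : ℂ)‖ = 1 := by
        rw [Complex.norm_eq_sqrt_sq_add_sq]; simp [e1]
      have hz0 : (⟨a, b⟩ : ℂ) ≠ 0 := by
        intro hz0; rw [hz0] at hz; simp at hz
      refine ⟨Complex.arg ⟨a, b⟩, ?_, ?_⟩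
      · rw [Complex.cos_arg hz0, hz]; simp
      · rw [Complex.sin_arg, hz]; simp
    refine ⟨θ, LinearMap.ext fun x => ?_⟩
    conv_lhs => rw [h.expand x]
    simp only [map_add, map_smul, hp, hv, hw0, hn0]
    simp only [rotation, LinearMap.coe_mk, AddHom.coe_mk, hc, hs, hda, hcb]
  · rintro ⟨θ, rfl⟩
    have hsc := Real.sin_sq_add_cos_sq θ
    refine ⟨fun x y => ?_, ?_, ?_, ?_⟩
    · conv_rhs => rw [h.expand x, h.expand y]
      simp only [rotation, LinearMap.coe_mk, AddHom.coe_mk, mink_add_left, mink_add_right,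
        mink_smul_left, mink_smul_right, hpp, h.pv, h.pw, h.pn, h.vv, h.ww, h.nn, h.vw, h.vn, h.wn,
        hvp, hwp, hnp, hwv, hnv, hnw]
      linear_combination (mink x w * mink y w + mink x n * mink y n) * hsc
    · simp [rotation, hpp, h.pv, h.pw, h.pn]
    · simp [rotation, hvp, h.vv, h.vw, h.vn]
    · rw [h.det_eq (rotation p v w n θ) (Real.cos θ) (Real.sin θ) (-Real.sin θ) (Real.cos θ)
        (by simp [rotation, hpp, h.pv, h.pw, h.pn]) (by simp [rotation, hvp, h.vv, h.vw, h.vn])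
        (by simp [rotation, hwp, hwv, h.ww, h.wn]) (by simp [rotation, hnp, hnv, hnw, h.nn])]
      linarith

end HypRev

end

open Set Filter Topology
open scoped ContDiff

namespace HypRev

/-! ### Maximum principle on a half-cylinder -/

/-! With `r = mink β w`, the induced metric is `|β'|² dt² + r² dθ²`. In the coordinate `s = ∫ |β'| /
r` it is conformal to the flat metric `ds² + dθ²` on a half-cylinder, and harmonicity is conformally
invariant in dimension two (`harmonic_equation`). Compactness bounds `r` by some `R`, so `s` is at
least the length divided by `R` and the half-cylinder is infinitely long
(`tendsto_integral_density`).

On an infinite half-cylinder a bounded harmonic `u` that is nonpositive on the boundary is compared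
with `ε log (1 + s)`. This barrier vanishes on the boundary, tends to infinity and is strictly
superharmonic, so `u - ε log (1 + s)` has no positive maximum; letting `ε → 0` gives `u ≤ 0`
(`nonpos_of_boundary_nonpos`). Applying this to both differences of two bounded harmonic functions
with equal boundary values gives uniqueness. -/

/-- Second derivative test at a local maximum for an operator in divergence form. -/
theorem divergence_nonpos_of_isLocalMax {f g b : ℝ → ℝ} {x D : ℝ} (hmax : IsLocalMax f x)
    (hf : ∀ᶠ y in 𝓝 x, HasDerivAt f (g y) y) (hb : ∀ᶠ y in 𝓝 x, 0 < b y)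
    (hD : HasDerivAt (fun y => b y * g y) D x) : D ≤ 0 := by
  by_contra! hpos
  have hgx : g x = 0 := hmax.hasDerivAt_eq_zero hf.self_of_nhds
  -- The flux `b * g` vanishes at `x` and would have positive derivative there, so `g > 0` just to
  -- the right of `x` and `f` would increase strictly from its maximum.
  have hslope : ∀ᶠ y in 𝓝[>] x, 0 < slope (fun y => b y * g y) x y :=
    ((hasDerivAt_iff_tendsto_slope.1 hD).mono_left
      (nhdsWithin_mono x fun y hy => ne_of_gt hy)).eventually (lt_mem_nhds hpos)
  have hgpos : ∀ᶠ y in 𝓝[>] x, 0 < g y := by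
    filter_upwards [hslope, hb.filter_mono nhdsWithin_le_nhds, self_mem_nhdsWithin]
      with y hy hby hxy
    have hxy' : 0 < y - x := sub_pos.2 hxy
    rw [slope_def_field, hgx, mul_zero, sub_zero] at hy
    exact pos_of_mul_pos_right ((div_pos_iff_of_pos_right hxy').1 hy) hby.le
  obtain ⟨z, hxz, hz⟩ := (mem_nhdsGT_iff_exists_Ioo_subset).1
    (hgpos.and ((hf.and hmax).filter_mono nhdsWithin_le_nhds))
  rw [mem_Ioi] at hxz
  have hm : (x + z) / 2 ∈ Ioo x z := ⟨by linarith, by linarith⟩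
  have hmono : StrictMonoOn f (Icc x ((x + z) / 2)) := by
    apply strictMonoOn_of_deriv_pos (convex_Icc _ _)
    · intro y hy
      rcases hy.1.eq_or_lt with rfl | h
      · exact hf.self_of_nhds.continuousAt.continuousWithinAt
      · exact (hz ⟨h, hy.2.trans_lt hm.2⟩).2.1.continuousAt.continuousWithinAt
    · intro y hy
      rw [interior_Icc] at hy
      have h := hz ⟨hy.1, hy.2.trans hm.2⟩
      rw [h.2.1.deriv]
      exact h.1
  exact absurd (hmono (left_mem_Icc.2 hm.1.le) (right_mem_Icc.2 hm.1.le) hm.1)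
    (not_lt.2 (hz hm).2.2)

/-- A function on the half-cylinder that is continuous, periodic in the angle, and negative far
out and on the boundary is nonpositive or has a positive interior maximum. -/
theorem exists_interior_max {f : ℝ × ℝ → ℝ} (hf : ContinuousOn f (Ici 0 ×ˢ univ)) {P T : ℝ}
    (hP : 0 < P) (hper : ∀ t θ : ℝ, 0 ≤ t → f (t, θ + P) = f (t, θ))
    (h0 : ∀ θ, f (0, θ) ≤ 0) (hT : ∀ t θ : ℝ, T ≤ t → f (t, θ) ≤ 0) {t θ : ℝ} (ht : 0 ≤ t)
    (hpos : 0 < f (t, θ)) :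
    ∃ t₀ θ₀ : ℝ, 0 < t₀ ∧ ∀ x y : ℝ, 0 ≤ x → f (x, y) ≤ f (t₀, θ₀) := by
  -- Periodicity reduces the angle to `[0, P]`, and positive values occur only for `t ≤ T`; a
  -- maximum over this rectangle is therefore global.
  have hcomp : IsCompact (Icc 0 T ×ˢ Icc 0 P) := isCompact_Icc.prod isCompact_Icc
  have hred : ∀ x y : ℝ, 0 ≤ x → ∃ y' ∈ Icc 0 P, f (x, y') = f (x, y) := by
    intro x y hx
    have hp : Function.Periodic (fun y => f (x, y)) P := fun y => hper x y hx
    obtain ⟨y', hy', h⟩ := hp.exists_mem_Ico₀ hP y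
    exact ⟨y', Ico_subset_Icc_self hy', h.symm⟩
  have hlt : ∀ x y : ℝ, 0 < f (x, y) → x ≤ T := by
    intro x y h
    by_contra! hx
    exact absurd (hT x y hx.le) (not_le.2 h)
  obtain ⟨θ', hθ', e⟩ := hred t θ ht
  obtain ⟨⟨t₀, θ₀⟩, hq, hmax⟩ := hcomp.exists_isMaxOn
    ⟨(t, θ'), ⟨ht, hlt t θ hpos⟩, hθ'⟩ (hf.mono fun q hq => ⟨hq.1.1, mem_univ _⟩)
  have hmpos : 0 < f (t₀, θ₀) := by
    have := hmax (show (t, θ') ∈ _ from ⟨⟨ht, hlt t θ hpos⟩, hθ'⟩)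
    simp only [mem_ofPred_eq] at this
    linarith
  refine ⟨t₀, θ₀, lt_of_le_of_ne hq.1.1 ?_, ?_⟩
  · rintro h
    have h' : t₀ = 0 := h.symm
    exact absurd (h0 θ₀) (not_le.2 (h' ▸ hmpos))
  · intro x y hx
    rcases le_or_gt (f (x, y)) 0 with h | h
    · linarith
    · obtain ⟨y', hy', e'⟩ := hred x y hx
      rw [← e']
      exact hmax (show (x, y') ∈ _ from ⟨⟨hx, hlt x y h⟩, hy'⟩)

/-- Bounded solutions of `∂ₜ(c⁻¹ ∂ₜu) + c ∂θ²u = 0` on the half-cylinder that are nonpositive on the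
boundary are nonpositive, provided `∫ c = ∞`. -/
theorem nonpos_of_boundary_nonpos {c : ℝ → ℝ} (hc : ContinuousOn c (Ici 0))
    (hcpos : ∀ t, 0 < t → 0 < c t)
    (hint : Tendsto (fun T : ℝ => ∫ t in (0 : ℝ)..T, c t) atTop atTop)
    {u u₁ u₂ : ℝ × ℝ → ℝ} (hu : ContinuousOn u (Ici 0 ×ˢ univ)) {P C : ℝ} (hP : 0 < P)
    (hper : ∀ t θ : ℝ, 0 ≤ t → u (t, θ + P) = u (t, θ))
    (hC : ∀ t θ : ℝ, 0 ≤ t → u (t, θ) ≤ C)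
    (hu₁ : ∀ t θ : ℝ, 0 < t → HasDerivAt (fun x => u (x, θ)) (u₁ (t, θ)) t)
    (hu₂ : ∀ t θ : ℝ, 0 < t → HasDerivAt (fun y => u (t, y)) (u₂ (t, θ)) θ)
    (heq : ∀ t θ : ℝ, 0 < t → ∃ D₁ D₂, HasDerivAt (fun x => (c x)⁻¹ * u₁ (x, θ)) D₁ t ∧
      HasDerivAt (fun y => u₂ (t, y)) D₂ θ ∧ D₁ + c t * D₂ = 0)
    (h0 : ∀ θ, u (0, θ) ≤ 0) {t θ : ℝ} (ht : 0 ≤ t) : u (t, θ) ≤ 0 := by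
  set s : ℝ → ℝ := fun T => ∫ t in (0 : ℝ)..T, c t with hs
  have hii : ∀ T, 0 ≤ T → IntervalIntegrable c MeasureTheory.volume 0 T := fun T hT =>
    (hc.mono (by rw [uIcc_of_le hT]; exact Icc_subset_Ici_self)).intervalIntegrable
  have hs0 : s 0 = 0 := by simp [hs]
  -- Positivity is assumed only for `t > 0`; continuity extends the weak inequality to `0`.
  have hcnn : ∀ t, 0 ≤ t → 0 ≤ c t := by
    intro t ht
    have : t ∈ closure (Ioi (0 : ℝ)) := by rw [closure_Ioi]; exact ht
    have : NeBot (𝓝[Ioi 0] t) := mem_closure_iff_nhdsWithin_neBot.1 this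
    exact ge_of_tendsto ((hc t ht).mono_left (nhdsWithin_mono t Ioi_subset_Ici_self))
      (eventually_mem_nhdsWithin.mono fun x hx => (hcpos x hx).le)
  have hsnn : ∀ t, 0 ≤ t → 0 ≤ s t := fun t ht =>
    intervalIntegral.integral_nonneg ht fun x hx => hcnn x hx.1
  have hsd : ∀ t, 0 < t → HasDerivAt s (c t) t := by
    intro t ht
    apply intervalIntegral.integral_hasDerivAt_right (hii t ht.le)
    · exact (hc.mono Ioi_subset_Ici_self).stronglyMeasurableAtFilter isOpen_Ioi t ht
    · exact hc.continuousAt (Ici_mem_nhds ht)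
  have hscont : ContinuousOn s (Ici 0) := by
    intro t ht
    have h := intervalIntegral.continuousOn_primitive_interval (μ := MeasureTheory.volume)
      (f := c) (a := 0) (b := t + 1) (by
        rw [uIcc_of_le (by linarith [mem_Ici.1 ht])]
        exact (hc.mono Icc_subset_Ici_self).integrableOn_Icc)
    rw [uIcc_of_le (by linarith [mem_Ici.1 ht])] at h
    refine (h t ⟨ht, by linarith⟩).mono_of_mem_nhdsWithin ?_
    rw [← Ici_inter_Iic]
    exact inter_mem self_mem_nhdsWithin (mem_nhdsWithin_of_mem_nhds (Iic_mem_nhds (by linarith)))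
  -- The function `s` itself is harmonic and would leave no strict inequality at the maximum. The
  -- logarithm is strictly concave in `s` and still unbounded.
  set φ : ℝ → ℝ := fun t => Real.log (1 + s t) with hφ
  have hφcont : ContinuousOn φ (Ici 0) :=
    (continuousOn_const.add hscont).log fun t ht => by
      have := hsnn t ht
      exact (by linarith : (0 : ℝ) < 1 + s t).ne'
  have hφlim : Tendsto φ atTop atTop :=
    Real.tendsto_log_atTop.comp (tendsto_atTop_add_const_left _ _ hint)
  have hφd : ∀ t, 0 < t → HasDerivAt φ (c t / (1 + s t)) t := fun t ht =>
    ((hsd t ht).const_add 1).log (by have := hsnn t ht.le; positivity)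
  have main : ∀ ε : ℝ, 0 < ε → u (t, θ) ≤ ε * φ t := by
    intro ε hε
    by_contra! hlt
    -- Beyond `T` the barrier `ε φ` exceeds the bound `C`. Taking `max T 0` keeps to the range where
    -- `hC` applies.
    obtain ⟨T, hT⟩ := eventually_atTop.1 (hφlim.eventually_ge_atTop (C / ε))
    obtain ⟨t₀, θ₀, ht₀, hmax⟩ := exists_interior_max (f := fun q => u q - ε * φ q.1)
      (T := max T 0) (t := t) (θ := θ)
      (hu.sub (continuousOn_const.mul (hφcont.comp continuousOn_fst fun q hq => hq.1))) hP
      (fun t θ ht => by simp only [hper t θ ht])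
      (fun θ => by simpa [hφ, hs0] using h0 θ)
      (fun t θ ht => by
        have h1 := hC t θ (le_of_max_le_right ht)
        have h2 := hT t (le_of_max_le_left ht)
        rw [div_le_iff₀ hε] at h2
        simp only
        linarith) ht (by simpa using hlt)
    obtain ⟨D₁, D₂, hD₁, hD₂, hD⟩ := heq t₀ θ₀ ht₀
    have hev : ∀ᶠ x in 𝓝 t₀, 0 < x := lt_mem_nhds ht₀
    have hct := hcpos t₀ ht₀
    have hst := hsnn t₀ ht₀.le
    have k₂ : D₂ ≤ 0 := by
      refine divergence_nonpos_of_isLocalMax (f := fun y => u (t₀, y)) (b := fun _ => 1)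
        (g := fun y => u₂ (t₀, y)) (x := θ₀) ?_ (.of_forall fun y => hu₂ t₀ y ht₀)
        (.of_forall fun _ => one_pos) (by simpa using hD₂)
      exact .of_forall fun y => by simpa using hmax t₀ y ht₀.le
    -- The flux of the barrier is `c⁻¹ φ' = (1 + s)⁻¹`, with derivative `-c / (1 + s)²`. With `k₂`
    -- this makes `D₁ + c D₂` negative, against the equation.
    have k₁ : D₁ + ε * (c t₀ / (1 + s t₀) ^ 2) ≤ 0 := by
      refine divergence_nonpos_of_isLocalMax (f := fun x => u (x, θ₀) - ε * φ x)
        (b := fun x => (c x)⁻¹) (g := fun x => u₁ (x, θ₀) - ε * (c x / (1 + s x))) (x := t₀)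
        ?_ ?_ ?_ ?_
      · exact hev.mono fun x hx => hmax x θ₀ hx.le
      · exact hev.mono fun x hx => (hu₁ x θ₀ hx).sub ((hφd x hx).const_mul ε)
      · exact hev.mono fun x hx => inv_pos.2 (hcpos x hx)
      · have h := hD₁.sub ((((hsd t₀ ht₀).const_add 1).inv (by positivity)).const_mul ε)
        refine (h.congr_of_eventuallyEq ?_).congr_deriv (by ring)
        filter_upwards [hev] with x hx
        have := (hcpos x hx).ne'
        simp only [Pi.sub_apply, Pi.inv_apply]
        field_simp
    have : 0 < ε * (c t₀ / (1 + s t₀) ^ 2) := by positivity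
    nlinarith
  refine le_of_forall_pos_le_add fun δ hδ => ?_
  have hφnn : 0 ≤ φ t := Real.log_nonneg (by linarith [hsnn t ht])
  -- The `+ 1` keeps the denominator positive, and `δ φ / (φ + 1) ≤ δ`.
  have := main (δ / (φ t + 1)) (by positivity)
  refine this.trans ?_
  rw [zero_add, div_mul_eq_mul_div, div_le_iff₀ (by positivity)]
  nlinarith

/-! ### Lorentz geometry -/

/-- A nonzero vector tangent to `ℍ³` is spacelike. -/
theorem mink_self_pos_of_orthogonal {x y : Fin 4 → ℝ} (hx : x ∈ H3) (hxy : mink x y = 0)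
    (hy : y ≠ 0) : 0 < mink y y := by
  obtain ⟨h1, h0⟩ := hx
  simp only [mink] at h1 hxy ⊢
  set S := y 1 ^ 2 + y 2 ^ 2 + y 3 ^ 2 with hS
  -- Cauchy–Schwarz for the spatial parts: orthogonality turns `x 0 * y 0` into their inner product,
  -- and `x 0 ^ 2 - 1` is the squared norm of that of `x`.
  have hcs : (x 0 * y 0) ^ 2 ≤ (x 0 ^ 2 - 1) * S := by
    have e1 : x 0 * y 0 = x 1 * y 1 + x 2 * y 2 + x 3 * y 3 := by linarith
    have e2 : x 0 ^ 2 - 1 = x 1 ^ 2 + x 2 ^ 2 + x 3 ^ 2 := by linarith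
    rw [e1, e2, hS]
    nlinarith [sq_nonneg (x 1 * y 2 - x 2 * y 1), sq_nonneg (x 1 * y 3 - x 3 * y 1),
      sq_nonneg (x 2 * y 3 - x 3 * y 2)]
  have hSpos : 0 < S := by
    by_contra! hle
    have z1 : y 1 = 0 := by nlinarith [sq_nonneg (y 1), sq_nonneg (y 2), sq_nonneg (y 3)]
    have z2 : y 2 = 0 := by nlinarith [sq_nonneg (y 1), sq_nonneg (y 2), sq_nonneg (y 3)]
    have z3 : y 3 = 0 := by nlinarith [sq_nonneg (y 1), sq_nonneg (y 2), sq_nonneg (y 3)]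
    have z0 : y 0 = 0 := by
      have : x 0 * y 0 = 0 := by simp only [z1, z2, z3] at hxy; linarith
      exact (mul_eq_zero.1 this).resolve_left h0.ne'
    exact hy (by ext i; fin_cases i <;> simp [z0, z1, z2, z3])
  have : 0 < x 0 ^ 2 * (S - y 0 ^ 2) := by nlinarith
  have := pos_of_mul_pos_right this (sq_nonneg _)
  linarith

theorem continuous_mink : Continuous fun q : (Fin 4 → ℝ) × (Fin 4 → ℝ) => mink q.1 q.2 := by
  unfold mink; fun_prop

theorem hasDerivAt_mink {f g : ℝ → Fin 4 → ℝ} {f' g' : Fin 4 → ℝ} {t : ℝ}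
    (hf : HasDerivAt f f' t) (hg : HasDerivAt g g' t) :
    HasDerivAt (fun x => mink (f x) (g x)) (mink f' (g t) + mink (f t) g') t := by
  rw [hasDerivAt_pi] at hf hg
  refine (((((hf 0).mul (hg 0)).neg.add ((hf 1).mul (hg 1))).add ((hf 2).mul (hg 2))).add
    ((hf 3).mul (hg 3))).congr_deriv ?_
  simp only [mink]
  ring

/-- A point of the open half-plane lies in the span of `p, v, w` and on the side of `w`. -/
theorem IsFrame.mem_halfPlane {p v w n x : Fin 4 → ℝ} (h : IsFrame p v w n)
    (hx : x ∈ halfPlane p v w) : mink x n = 0 ∧ 0 < mink x w := by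
  obtain ⟨t₁, t₂, ht, rfl⟩ := hx
  have e : mink (t₁ • v + t₂ • w) (t₁ • v + t₂ • w) = t₁ ^ 2 + t₂ ^ 2 := by
    simp only [mink_add_left, mink_add_right, mink_smul_left, mink_smul_right, h.vv, h.ww, h.vw,
      mink_comm w v]
    ring
  -- Since `t₂ > 0`, the quotient `sinh ρ / ρ` in `hypExp` is not the default value of `0 / 0`, and
  -- the `w`-component `(sinh ρ / ρ) t₂` is positive.
  have hpos : 0 < Real.sqrt (t₁ ^ 2 + t₂ ^ 2) := by positivity
  have := Real.sinh_pos_iff.2 hpos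
  simp only [hypExp, e, mink_add_left, mink_smul_left, h.pn, h.vn, h.wn, h.pw, h.vw, h.ww]
  constructor
  · ring
  · ring_nf
    positivity

/-! ### The induced metric of an end of revolution -/

theorem IsFrame.mink_rotation {p v w n : Fin 4 → ℝ} (h : IsFrame p v w n) (θ : ℝ)
    (x y : Fin 4 → ℝ) : mink (rotation p v w n θ x) (rotation p v w n θ y) = mink x y :=
  ((h.mem_rotationGroup_iff _).2 ⟨θ, rfl⟩).1 x y

/-- The unit tangent vector `-sin θ w + cos θ n` of the parallels. -/
noncomputable def parallel (w n : Fin 4 → ℝ) (θ : ℝ) : Fin 4 → ℝ := -Real.sin θ • w + Real.cos θ • n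

theorem IsFrame.mink_parallel {p v w n : Fin 4 → ℝ} (h : IsFrame p v w n) (θ : ℝ) :
    mink (parallel w n θ) (parallel w n θ) = 1 := by
  simp only [parallel, mink_add_left, mink_add_right, mink_smul_left, mink_smul_right, h.ww, h.nn,
    h.wn, mink_comm n w]
  nlinarith [Real.sin_sq_add_cos_sq θ]

/-- `parallel w n θ` is the image of `n` under the rotation, which is an isometry. -/
theorem IsFrame.mink_rotation_parallel {p v w n : Fin 4 → ℝ} (h : IsFrame p v w n) (θ : ℝ)
    (x : Fin 4 → ℝ) : mink (rotation p v w n θ x) (parallel w n θ) = mink x n := by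
  simp only [rotation, LinearMap.coe_mk, AddHom.coe_mk, parallel, mink_add_left, mink_add_right,
    mink_smul_left, mink_smul_right, h.ww, h.nn, h.wn, mink_comm n w, h.pw, h.pn, h.vw, h.vn]
  linear_combination mink x n * Real.sin_sq_add_cos_sq θ

/-- Speed of the generating curve. -/
noncomputable def speed (β : ℝ → Fin 4 → ℝ) (t : ℝ) : ℝ := Real.sqrt (mink (velocity β t) (velocity β t))

section

variable {p v w n : Fin 4 → ℝ} {β : ℝ → Fin 4 → ℝ}

theorem IsGeneratingCurve.hasDerivAt (hβ : IsGeneratingCurve p v w β) {t : ℝ} (ht : 0 < t) :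
    HasDerivAt β (velocity β t) t :=
  (((hβ.smooth.differentiableOn (by simp)) t ht.le).hasDerivWithinAt).hasDerivAt
    (Ici_mem_nhds ht)

theorem IsGeneratingCurve.contDiffOn_velocity (hβ : IsGeneratingCurve p v w β) :
    ContDiffOn ℝ ∞ (velocity β) (Ici 0) :=
  ((contDiffOn_infty_iff_derivWithin (uniqueDiffOn_Ici 0)).1 hβ.smooth).2

theorem IsGeneratingCurve.continuousOn_speed (hβ : IsGeneratingCurve p v w β) :
    ContinuousOn (speed β) (Ici 0) := by
  have h := hβ.contDiffOn_velocity.continuousOn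
  exact (continuous_mink.comp_continuousOn (h.prodMk h)).sqrt

/-- Differentiating `mink β β = -1` shows that the velocity is tangent to the hyperboloid, hence
spacelike once regularity makes it nonzero. -/
theorem IsGeneratingCurve.mink_velocity_pos (hβ : IsGeneratingCurve p v w β)
    (hH : ∀ t, 0 ≤ t → β t ∈ H3) {t : ℝ} (ht : 0 < t) :
    0 < mink (velocity β t) (velocity β t) := by
  refine mink_self_pos_of_orthogonal (hH t ht.le) ?_ (hβ.regular t ht.le)
  have h1 := hasDerivAt_mink (hβ.hasDerivAt ht) (hβ.hasDerivAt ht)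
  have h2 : HasDerivAt (fun x => mink (β x) (β x)) 0 t :=
    (hasDerivAt_const t (-1 : ℝ)).congr_of_eventuallyEq
      ((lt_mem_nhds ht).mono fun x hx => (hH x (le_of_lt hx)).1)
  have := h1.unique h2
  rw [mink_comm (velocity β t)] at this
  linarith

theorem IsGeneratingCurve.differentiableAt_speed (hβ : IsGeneratingCurve p v w β)
    (hH : ∀ t, 0 ≤ t → β t ∈ H3) {t : ℝ} (ht : 0 < t) : DifferentiableAt ℝ (speed β) t := by
  have h : DifferentiableAt ℝ (velocity β) t :=
    (hβ.contDiffOn_velocity.differentiableOn (by simp) t ht.le).differentiableAt (Ici_mem_nhds ht)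
  exact (hasDerivAt_mink h.hasDerivAt h.hasDerivAt).differentiableAt.sqrt
    (hβ.mink_velocity_pos hH ht).ne'

/-- The curve stays in the hyperplane orthogonal to `n`. This is what makes meridians and parallels
orthogonal. -/
theorem IsGeneratingCurve.mink_velocity_normal (hβ : IsGeneratingCurve p v w β)
    (h : IsFrame p v w n) {t : ℝ} (ht : 0 < t) : mink (velocity β t) n = 0 := by
  have h1 := hasDerivAt_mink (hβ.hasDerivAt ht) (hasDerivAt_const t n)
  have h2 : HasDerivAt (fun x => mink (β x) n) 0 t :=
    (hasDerivAt_const t (0 : ℝ)).congr_of_eventuallyEq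
      ((lt_mem_nhds ht).mono fun x hx => (h.mem_halfPlane (hβ.mem x (le_of_lt hx))).1)
  simpa [mink] using h1.unique h2

theorem IsGeneratingCurve.d₁_immersion (hβ : IsGeneratingCurve p v w β) {t : ℝ} (ht : 0 < t)
    (θ : ℝ) : d₁ (immersion p v w n β) (t, θ) = rotation p v w n θ (velocity β t) :=
  ((LinearMap.toContinuousLinearMap (rotation p v w n θ)).hasFDerivAt.comp_hasDerivAt t
    (hβ.hasDerivAt ht)).deriv

/-- Because `β t` has no `n`-component, its orbit is a circle whose radius is its `w`-component. -/
theorem IsGeneratingCurve.d₂_immersion (hβ : IsGeneratingCurve p v w β) (h : IsFrame p v w n)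
    {t : ℝ} (ht : 0 < t) (θ : ℝ) :
    d₂ (immersion p v w n β) (t, θ) = mink (β t) w • parallel w n θ := by
  have hn := (h.mem_halfPlane (hβ.mem t ht.le)).1
  refine HasDerivAt.deriv ?_
  simp only [immersion, rotation, LinearMap.coe_mk, AddHom.coe_mk, hn, zero_smul, add_zero]
  exact ((((Real.hasDerivAt_cos θ).smul_const w).add
    ((Real.hasDerivAt_sin θ).smul_const n)).const_smul (mink (β t) w)).const_add _

theorem IsGeneratingCurve.g₁₁_immersion (hβ : IsGeneratingCurve p v w β) (h : IsFrame p v w n)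
    (hH : ∀ t, 0 ≤ t → β t ∈ H3) {t : ℝ} (ht : 0 < t) (θ : ℝ) :
    g₁₁ (immersion p v w n β) (t, θ) = speed β t ^ 2 := by
  rw [g₁₁, hβ.d₁_immersion ht, h.mink_rotation, speed,
    Real.sq_sqrt (hβ.mink_velocity_pos hH ht).le]

theorem IsGeneratingCurve.g₁₂_immersion (hβ : IsGeneratingCurve p v w β) (h : IsFrame p v w n)
    {t : ℝ} (ht : 0 < t) (θ : ℝ) : g₁₂ (immersion p v w n β) (t, θ) = 0 := by
  rw [g₁₂, hβ.d₁_immersion ht, hβ.d₂_immersion h ht, mink_smul_right, h.mink_rotation_parallel,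
    hβ.mink_velocity_normal h ht, mul_zero]

theorem IsGeneratingCurve.g₂₂_immersion (hβ : IsGeneratingCurve p v w β) (h : IsFrame p v w n)
    {t : ℝ} (ht : 0 < t) (θ : ℝ) : g₂₂ (immersion p v w n β) (t, θ) = mink (β t) w ^ 2 := by
  rw [g₂₂, hβ.d₂_immersion h ht, mink_smul_left, mink_smul_right, h.mink_parallel]
  ring

theorem IsGeneratingCurve.speed_pos (hβ : IsGeneratingCurve p v w β)
    (hH : ∀ t, 0 ≤ t → β t ∈ H3) {t : ℝ} (ht : 0 < t) : 0 < speed β t :=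
  Real.sqrt_pos.2 (hβ.mink_velocity_pos hH ht)

theorem IsGeneratingCurve.area_immersion (hβ : IsGeneratingCurve p v w β) (h : IsFrame p v w n)
    (hH : ∀ t, 0 ≤ t → β t ∈ H3) {t : ℝ} (ht : 0 < t) (θ : ℝ) :
    area (immersion p v w n β) (t, θ) = speed β t * mink (β t) w := by
  rw [area, hβ.g₁₁_immersion h hH ht, hβ.g₁₂_immersion h ht, hβ.g₂₂_immersion h ht]
  have h1 := (h.mem_halfPlane (hβ.mem t ht.le)).2
  have h2 := hβ.speed_pos hH ht
  rw [show speed β t ^ 2 * mink (β t) w ^ 2 - 0 ^ 2 = (speed β t * mink (β t) w) ^ 2 by ring,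
    Real.sqrt_sq (by positivity)]

/-! ### Conformal density and the harmonic equation -/

/-- The conformal density `|β'| / r` of the end of revolution, where `r = mink β w`. -/
noncomputable def density (w : Fin 4 → ℝ) (β : ℝ → Fin 4 → ℝ) (t : ℝ) : ℝ := speed β t / mink (β t) w

theorem IsGeneratingCurve.density_pos (hβ : IsGeneratingCurve p v w β) (h : IsFrame p v w n)
    (hH : ∀ t, 0 ≤ t → β t ∈ H3) {t : ℝ} (ht : 0 < t) : 0 < density w β t :=
  div_pos (hβ.speed_pos hH ht) (h.mem_halfPlane (hβ.mem t ht.le)).2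

theorem IsGeneratingCurve.continuousOn_density (hβ : IsGeneratingCurve p v w β)
    (h : IsFrame p v w n) : ContinuousOn (density w β) (Ici 0) :=
  hβ.continuousOn_speed.div
    (continuous_mink.comp_continuousOn (hβ.smooth.continuousOn.prodMk continuousOn_const))
    fun t ht => (h.mem_halfPlane (hβ.mem t ht)).2.ne'

/-- Harmonicity on an end of revolution is the equation `∂ₜ(c⁻¹ ∂ₜu) + c ∂θ²u = 0`, with `c` the
conformal density. -/
theorem IsGeneratingCurve.harmonic_equation (hβ : IsGeneratingCurve p v w β)
    (h : IsFrame p v w n) (hH : ∀ t, 0 ≤ t → β t ∈ H3) {u : ℝ × ℝ → ℝ} {t θ : ℝ} (ht : 0 < t)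
    (hu₁ : DifferentiableAt ℝ (fun x => d₁ u (x, θ)) t)
    (hu₂ : DifferentiableAt ℝ (fun y => d₂ u (t, y)) θ)
    (hu : laplacian (immersion p v w n β) u (t, θ) = 0) :
    ∃ D₁ D₂, HasDerivAt (fun x => (density w β x)⁻¹ * d₁ u (x, θ)) D₁ t ∧
      HasDerivAt (fun y => d₂ u (t, y)) D₂ θ ∧ D₁ + density w β t * D₂ = 0 := by
  have hA := fun x (hx : 0 < x) => (h.mem_halfPlane (hβ.mem x (le_of_lt hx))).2
  have hs := fun x (hx : 0 < x) => hβ.speed_pos hH hx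
  have hc : DifferentiableAt ℝ (density w β) t :=
    (hβ.differentiableAt_speed hH ht).div
      (hasDerivAt_mink (hβ.hasDerivAt ht) (hasDerivAt_const t w)).differentiableAt (hA t ht).ne'
  have hD₁ := ((hc.inv (hβ.density_pos h hH ht).ne').mul hu₁).hasDerivAt
  refine ⟨_, _, hD₁, hu₂.hasDerivAt, ?_⟩
  rw [laplacian, mul_eq_zero, inv_eq_zero, hβ.area_immersion h hH ht] at hu
  have hu := hu.resolve_left (mul_pos (hs t ht) (hA t ht)).ne'
  -- Here `g₂₂ / area = r / |β'|` is the inverse density. The formulas hold only for positive `t`,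
  -- which suffices near the point.
  have e₁ : d₁ (fun r => (g₂₂ (immersion p v w n β) r * d₁ u r
      - g₁₂ (immersion p v w n β) r * d₂ u r) / area (immersion p v w n β) r) (t, θ)
      = deriv (fun x => (density w β x)⁻¹ * d₁ u (x, θ)) t := by
    refine Filter.EventuallyEq.deriv_eq ((lt_mem_nhds ht).mono fun x hx => ?_)
    have h1 := (hA x hx).ne'
    have h2 := (hs x hx).ne'
    simp only [hβ.g₂₂_immersion h hx, hβ.g₁₂_immersion h hx, hβ.area_immersion h hH hx, density]
    field_simp
    ring
  -- The coefficient `g₁₁ / area` is the density; it depends on `t` alone, so it leaves the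
  -- `θ`-derivative.
  have e₂ : d₂ (fun r => (g₁₁ (immersion p v w n β) r * d₂ u r
      - g₁₂ (immersion p v w n β) r * d₁ u r) / area (immersion p v w n β) r) (t, θ)
      = density w β t * deriv (fun y => d₂ u (t, y)) θ := by
    rw [← deriv_const_mul _ hu₂]
    refine congrArg (fun f => deriv f θ) (funext fun y => ?_)
    have h1 := (hA t ht).ne'
    have h2 := (hs t ht).ne'
    simp only [hβ.g₁₁_immersion h hH ht, hβ.g₁₂_immersion h ht, hβ.area_immersion h hH ht, density]
    field_simp
    ring
  rw [e₁, e₂] at hu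
  exact hu

/-- On a bounded end of revolution of infinite length the conformal density has infinite
integral. -/
theorem IsGeneratingCurve.tendsto_integral_density (hβ : IsGeneratingCurve p v w β)
    (h : IsFrame p v w n) (hlength : HasInfiniteLength β) {R : ℝ} (hR : 0 < R)
    (hb : ∀ t, 0 ≤ t → mink (β t) w ≤ R) :
    Tendsto (fun T : ℝ => ∫ t in (0 : ℝ)..T, density w β t) atTop atTop := by
  -- Since `r ≤ R`, the density is at least `R⁻¹ |β'|`, so its integral dominates the length divided
  -- by `R`.
  refine tendsto_atTop_mono' _ ?_ (hlength.const_mul_atTop (inv_pos.2 hR))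
  filter_upwards [eventually_ge_atTop 0] with T hT
  rw [← intervalIntegral.integral_const_mul]
  have hsub : uIcc 0 T ⊆ Ici 0 := by rw [uIcc_of_le hT]; exact Icc_subset_Ici_self
  refine intervalIntegral.integral_mono_on hT
    ((continuousOn_const.mul hβ.continuousOn_speed).mono hsub).intervalIntegrable
    ((hβ.continuousOn_density h).mono hsub).intervalIntegrable fun t ht => ?_
  have hpos := (h.mem_halfPlane (hβ.mem t ht.1)).2
  rw [density, ← inv_mul_eq_div]
  exact mul_le_mul_of_nonneg_right (inv_anti₀ hpos (hb t ht.1)) (Real.sqrt_nonneg _)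

end

/-! ### Partial derivatives of `C²` functions -/

theorem differentiableAt_of_contDiffOn {u : ℝ × ℝ → ℝ} (hu : ContDiffOn ℝ 2 u (Ioi 0 ×ˢ univ))
    {t θ : ℝ} (ht : 0 < t) : DifferentiableAt ℝ u (t, θ) :=
  (hu.contDiffAt ((isOpen_Ioi.prod isOpen_univ).mem_nhds
    (show (t, θ) ∈ Ioi (0 : ℝ) ×ˢ univ from ⟨ht, mem_univ _⟩))).differentiableAt
    (by simp)

theorem hasDerivAt_prodMk_left (t θ : ℝ) : HasDerivAt (fun x : ℝ => (x, θ)) ((1 : ℝ), (0 : ℝ)) t :=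
  (hasDerivAt_id t).prodMk (hasDerivAt_const t θ)

theorem hasDerivAt_prodMk_right (t θ : ℝ) : HasDerivAt (fun y : ℝ => (t, y)) ((0 : ℝ), (1 : ℝ)) θ :=
  (hasDerivAt_const θ t).prodMk (hasDerivAt_id θ)

theorem hasDerivAt_d₁ {u : ℝ × ℝ → ℝ} {t θ : ℝ} (hu : DifferentiableAt ℝ u (t, θ)) :
    HasDerivAt (fun x => u (x, θ)) (d₁ u (t, θ)) t :=
  (hu.hasFDerivAt.comp_hasDerivAt t (hasDerivAt_prodMk_left t θ)).differentiableAt.hasDerivAt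

theorem hasDerivAt_d₂ {u : ℝ × ℝ → ℝ} {t θ : ℝ} (hu : DifferentiableAt ℝ u (t, θ)) :
    HasDerivAt (fun y => u (t, y)) (d₂ u (t, θ)) θ :=
  (hu.hasFDerivAt.comp_hasDerivAt θ (hasDerivAt_prodMk_right t θ)).differentiableAt.hasDerivAt

theorem differentiableAt_fderiv_of_contDiffOn {u : ℝ × ℝ → ℝ}
    (hu : ContDiffOn ℝ 2 u (Ioi 0 ×ˢ univ)) {t θ : ℝ} (ht : 0 < t) :
    DifferentiableAt ℝ (fderiv ℝ u) (t, θ) :=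
  ((hu.contDiffAt ((isOpen_Ioi.prod isOpen_univ).mem_nhds
    (show (t, θ) ∈ Ioi (0 : ℝ) ×ˢ univ from ⟨ht, mem_univ _⟩))).fderiv_right
    (m := 1) (by norm_num)).differentiableAt (by simp)

/-- Near the point the partial derivative is `fderiv` applied to the constant vector `(1, 0)`, and
`fderiv` of a `C²` function is differentiable. -/
theorem differentiableAt_d₁ {u : ℝ × ℝ → ℝ} (hu : ContDiffOn ℝ 2 u (Ioi 0 ×ˢ univ)) {t θ : ℝ}
    (ht : 0 < t) : DifferentiableAt ℝ (fun x => d₁ u (x, θ)) t := by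
  have h := (differentiableAt_fderiv_of_contDiffOn hu (θ := θ) ht).comp t
    (hasDerivAt_prodMk_left t θ).differentiableAt
  refine (h.clm_apply (differentiableAt_const ((1 : ℝ), (0 : ℝ)))).congr_of_eventuallyEq
    ((lt_mem_nhds ht).mono fun x hx => ?_)
  exact ((differentiableAt_of_contDiffOn hu (θ := θ) hx).hasFDerivAt.comp_hasDerivAt x
    (hasDerivAt_prodMk_left x θ)).deriv

theorem differentiableAt_d₂ {u : ℝ × ℝ → ℝ} (hu : ContDiffOn ℝ 2 u (Ioi 0 ×ˢ univ)) {t θ : ℝ}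
    (ht : 0 < t) : DifferentiableAt ℝ (fun y => d₂ u (t, y)) θ := by
  have h := (differentiableAt_fderiv_of_contDiffOn hu (θ := θ) ht).comp θ
    (hasDerivAt_prodMk_right t θ).differentiableAt
  refine (h.clm_apply (differentiableAt_const ((0 : ℝ), (1 : ℝ)))).congr_of_eventuallyEq
    (.of_forall fun y => ?_)
  exact ((differentiableAt_of_contDiffOn hu ht).hasFDerivAt.comp_hasDerivAt y
    (hasDerivAt_prodMk_right t y)).deriv

/-! ### Comparison principle and parabolicity -/

/-- Comparison principle for bounded harmonic functions on a bounded end of revolution of infinite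
length. -/
theorem IsGeneratingCurve.le_of_boundary_eq {p v w n : Fin 4 → ℝ} {β : ℝ → Fin 4 → ℝ}
    (hβ : IsGeneratingCurve p v w β) (h : IsFrame p v w n) (hH : ∀ t, 0 ≤ t → β t ∈ H3)
    (hlength : HasInfiniteLength β) {R : ℝ} (hR : 0 < R)
    (hb : ∀ t, 0 ≤ t → mink (β t) w ≤ R) {f g : ℝ × ℝ → ℝ}
    (hf : IsBoundedHarmonic (immersion p v w n β) f)
    (hg : IsBoundedHarmonic (immersion p v w n β) g) (h0 : ∀ θ : ℝ, f (0, θ) = g (0, θ)) {t θ : ℝ}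
    (ht : 0 ≤ t) : f (t, θ) ≤ g (t, θ) := by
  obtain ⟨A, hA⟩ := hf.bounded
  obtain ⟨B, hB⟩ := hg.bounded
  refine sub_nonpos.1 (nonpos_of_boundary_nonpos (u := fun q => f q - g q)
    (u₁ := fun q => d₁ f q - d₁ g q) (u₂ := fun q => d₂ f q - d₂ g q) (C := A + B)
    (hβ.continuousOn_density h) (fun t ht => hβ.density_pos h hH ht)
    (hβ.tendsto_integral_density h hlength hR hb) (hf.continuousOn.sub hg.continuousOn)
    Real.two_pi_pos ?_ ?_ ?_ ?_ ?_ ?_ ht)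
  · intro t θ ht
    simp only [hf.periodic t θ ht, hg.periodic t θ ht]
  · intro t θ ht
    linarith [(abs_le.1 (hA t θ ht)).2, (abs_le.1 (hB t θ ht)).1]
  · exact fun t θ ht => (hasDerivAt_d₁ (differentiableAt_of_contDiffOn hf.contDiffOn ht)).sub
      (hasDerivAt_d₁ (differentiableAt_of_contDiffOn hg.contDiffOn ht))
  · exact fun t θ ht => (hasDerivAt_d₂ (differentiableAt_of_contDiffOn hf.contDiffOn ht)).sub
      (hasDerivAt_d₂ (differentiableAt_of_contDiffOn hg.contDiffOn ht))
  · intro t θ ht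
    obtain ⟨D₁, D₂, hD₁, hD₂, hD⟩ := hβ.harmonic_equation h hH ht
      (differentiableAt_d₁ hf.contDiffOn ht) (differentiableAt_d₂ hf.contDiffOn ht)
      (hf.harmonic t θ ht)
    obtain ⟨D₁', D₂', hD₁', hD₂', hD'⟩ := hβ.harmonic_equation h hH ht
      (differentiableAt_d₁ hg.contDiffOn ht) (differentiableAt_d₂ hg.contDiffOn ht)
      (hg.harmonic t θ ht)
    refine ⟨D₁ - D₁', D₂ - D₂', ?_, hD₂.sub hD₂', by linear_combination hD - hD'⟩
    simp only [mul_sub]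
    exact hD₁.sub hD₁'
  · intro θ
    simp only [h0 θ, sub_self, le_refl]

end HypRev

/-- A complete end of revolution in hyperbolic space that is contained in a compact set of
hyperbolic space is parabolic. -/
theorem corollaryD
    (p v w n : Fin 4 → ℝ) (hframe : HypRev.IsFrame p v w n)
    (β : ℝ → Fin 4 → ℝ) (hβ : HypRev.IsGeneratingCurve p v w β)
    (hlength : HypRev.HasInfiniteLength β)
    (K : Set (Fin 4 → ℝ)) (hK : IsCompact K) (hKH : K ⊆ HypRev.H3)
    (hE : HypRev.endOfRevolution p v β ⊆ K) :
    HypRev.IsParabolic (HypRev.immersion p v w n β) := by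
  -- The identity is a rotation, so the generating curve lies in the end.
  have hβK : ∀ t, 0 ≤ t → β t ∈ K := fun t ht =>
    hE ⟨t, ht, LinearMap.id, ⟨fun _ _ => rfl, rfl, rfl, LinearMap.det_id⟩, rfl⟩
  have hH : ∀ t, 0 ≤ t → β t ∈ HypRev.H3 := fun t ht => hKH (hβK t ht)
  -- Compactness enters the estimate only here: it bounds the radius of the parallels.
  obtain ⟨R, hR⟩ := (hK.image (f := fun x => HypRev.mink x w)
    (HypRev.continuous_mink.comp (Continuous.prodMk_left w))).bddAbove
  have hb : ∀ t, 0 ≤ t → HypRev.mink (β t) w ≤ R := fun t ht => hR ⟨_, hβK t ht, rfl⟩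
  have hRpos : 0 < R := (hframe.mem_halfPlane (hβ.mem 0 le_rfl)).2.trans_le (hb 0 le_rfl)
  intro f g hf hg h0 t θ ht
  exact le_antisymm (hβ.le_of_boundary_eq hframe hH hlength hRpos hb hf hg h0 ht)
    (hβ.le_of_boundary_eq hframe hH hlength hRpos hb hg hf (fun θ => (h0 θ).symm) ht)
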